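/- For graphs $G$ and $H$ write $G\to H$ if every red/blue colouring of the edges of $G$ contains a monochromatic (not necessarily induced) copy of $H$. Let $\hat r(H)=\min\{|E(G)| : G \text{ a finite graph},\ G\to H\}$ be the size-Ramsey number of $H$ and let $r(K_t)$ be the least $N$ with $K_N\to K_t$. For a graph $H$ and an integer $k\ge 1$, the $k$-th power $H^k$ is the graph on $V(H)$ in which two distinct vertices are adjacent if and only if their distance in $H$ is at most $k$. For $t\in\mathbb N$, the complete-$t$-blow-up $H_t$ of $H$ is obtained by replacing each vertex of $H$ by a clique on $r(K_t)$ vertices and joining completely the cliques of adjacent vertices; $H^k_t$ denotes the complete-$t$-blow-up of $H^k$. Let $P_n$ be the path on $n$ vertices. **Theorem.** Let $k\ge 2$ be an integer. (1) $\hat r(P_n^k)=O(n)$ as $n\to\infty$: there is a constant $C$, depending only on $k$, such that $\hat r(P_n^k)\le Cn$ for all sufficiently large $n$. (2) This bound is witnessed by complete blow-ups of powers of sparse pseudo-random graphs of bounded degree: there is $t\in\mathbb N$, depending only on $k$, such that for every $\varepsilon>0$ there are $a,b,C\in\mathbb N$ such that for all sufficiently large $n$ there is a graph $H$ on $an$ vertices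 such that - for every pair of disjoint sets $S,T\subseteq V(H)$ with $|S|,|T|\ge \varepsilon n$ there is an edge of $H$ between $S$ and $T$; - every vertex of $H$ has degree at most $b$; - $|E(H^k_t)|\le Cn$; - $H^k_t\to P_n^k$. -/

import Mathlib

namespace SizeRamsey

/-- `G → (H)_q`: every `q`-colouring of the edges of `G` contains a monochromatic copy of `H`,
that is, a (not necessarily induced) subgraph isomorphic to `H` all of whose edges have one
colour. -/
def IsRamseyFor {V W : Type*} (q : ℕ) (G : SimpleGraph V) (H : SimpleGraph W) : Prop :=
  ∀ c : G.EdgeLabeling (Fin q), ∃ i : Fin q, H.IsContained (c.labelGraph i)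

/-- The two-colour Ramsey number `r(H)`: the least `N` with `K_N → H` (for finite `H` such an `N`
exists by Ramsey's theorem). -/
noncomputable def ramseyNumber {W : Type*} (H : SimpleGraph W) : ℕ :=
  sInf {N : ℕ | IsRamseyFor 2 (⊤ : SimpleGraph (Fin N)) H}

/-- The size-Ramsey number `r̂(H)`: the least number of edges of a finite graph `G` with `G → H`.
It takes values in `ℕ∞`, with value `⊤` if there were no such graph, so that an upper bound by a
natural number includes the existence of `G`. -/
noncomputable def sizeRamseyNumber {W : Type*} (H : SimpleGraph W) : ℕ∞ :=
  ⨅ (m : ℕ) (G : SimpleGraph (Fin m)) (_ : IsRamseyFor 2 G H), G.edgeSet.encard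

/-- The `k`-th power of a graph: distinct vertices are adjacent if their distance is at most `k`
(the distance is `⊤` between different connected components). -/
def power {V : Type*} (G : SimpleGraph V) (k : ℕ) : SimpleGraph V where
  Adj u v := u ≠ v ∧ G.edist u v ≤ k
  symm := ⟨fun _ _ h => ⟨h.1.symm, by rw [SimpleGraph.edist_comm]; exact h.2⟩⟩
  loopless := ⟨fun _ h => h.1 rfl⟩

/-- `P_n^k`, the `k`-th power of the path on `n` vertices. -/
def pathPower (n k : ℕ) : SimpleGraph (Fin n) :=
  power (SimpleGraph.pathGraph n) k

/-- The complete-`t`-blow-up of `G`: each vertex `v` is replaced by a clique, its cluster, on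
`r(K_t)` vertices, and all edges are put between the clusters of adjacent vertices. -/
def completeBlowup {V : Type*} (t : ℕ) (G : SimpleGraph V) :
    SimpleGraph (V × Fin (ramseyNumber (⊤ : SimpleGraph (Fin t)))) where
  Adj x y := x ≠ y ∧ (x.1 = y.1 ∨ G.Adj x.1 y.1)
  symm := ⟨fun _ _ h => ⟨h.1.symm, h.2.imp Eq.symm (fun h' => h'.symm)⟩⟩
  loopless := ⟨fun _ h => h.1 rfl⟩

/-- The pseudo-randomness property with threshold `s`: there is an edge between any two disjoint
sets of at least `s` vertices each. -/
def IsPseudoRandom {V : Type*} (H : SimpleGraph V) (s : ℝ) : Prop :=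
  ∀ S T : Finset V, Disjoint S T → s ≤ (S.card : ℝ) → s ≤ (T.card : ℝ) →
    ∃ u ∈ S, ∃ v ∈ T, H.Adj u v

end SizeRamsey

/-! Let `H` be a pseudo-random graph of bounded degree and two-colour the edges of `H^k_t`. Every
cluster contains a monochromatic `K_t`, and for at least half of the vertices of `H` it has the same
colour, say red. Relate two such vertices if there is a red `K_{2k,2k}` between their cliques.

If this relation has a path on `n + 2` vertices, the red cliques and bicliques along it contain a
red `P_n^k` (`pathPower_isContained_of_bicliques`). Otherwise repeated depth-first search yields `k
+ 1` large disjoint sets with no related pair across them (`exists_path_or_unrelated_family`). A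
second search, with pseudo-randomness, gives a path of `H` winding cyclically through these sets
(`exists_cyclic_path`). Vertices at most `k` steps apart on it lie in different sets and are
adjacent in `H^k`, so all edges between their cliques are present without a red biclique. Blue is
then dense enough to pick one vertex from each clique greedily and form a blue `P_n^k`
(`exists_transversal`).

A suitable `H` exists by counting tuples of functions and discarding points of high in-degree
(`exists_bounded_degree_pseudoRandom`). Its blown-up power has bounded degree, hence linearly many
edges. -/

namespace SizeRamsey

open Finset

/-! ### Depth-first search and winding paths -/

/-- `p 0, …, p (n - 1)` is a directed path of the relation `R` inside `W`. -/
structure IsPathIn {V : Type*} (R : V → V → Prop) (W : Finset V) (p : ℕ → V) (n : ℕ) : Prop where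
  mem : ∀ i < n, p i ∈ W
  inj : ∀ i < n, ∀ j < n, p i = p j → i = j
  step : ∀ i, i + 1 < n → R (p i) (p (i + 1))

theorem IsPathIn.mono {V : Type*} {R : V → V → Prop} {W W' : Finset V} {p : ℕ → V} {n m : ℕ}
    (h : IsPathIn R W p n) (hW : W ⊆ W') (hm : m ≤ n) : IsPathIn R W' p m :=
  ⟨fun i hi => hW (h.mem i (by omega)), fun i hi j hj => h.inj i (by omega) j (by omega),
    fun i hi => h.step i (by omega)⟩

theorem IsPathIn.snoc {V : Type*} {R : V → V → Prop} {W : Finset V} {p : ℕ → V}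
    {n : ℕ} (h : IsPathIn R W p n) {y : V} (hy : y ∈ W) (hne : ∀ i < n, p i ≠ y)
    (hR : ∀ i, i + 1 = n → R (p i) y) : IsPathIn R W (Function.update p n y) (n + 1) := by
  have h1 : ∀ i < n, Function.update p n y i = p i := fun i hi =>
    Function.update_of_ne (by omega) _ _
  have h2 : Function.update p n y n = y := Function.update_self _ _ _
  refine ⟨fun i hi => ?_, fun i hi j hj hij => ?_, fun i hi => ?_⟩
  · rcases Nat.lt_succ_iff_lt_or_eq.mp hi with h' | rfl
    · rw [h1 i h']; exact h.mem i h'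
    · rwa [h2]
  · rcases Nat.lt_succ_iff_lt_or_eq.mp hi with hi | rfl <;>
      rcases Nat.lt_succ_iff_lt_or_eq.mp hj with hj | rfl
    · rw [h1 i hi, h1 j hj] at hij; exact h.inj i hi j hj hij
    · rw [h1 i hi, h2] at hij; exact absurd hij (hne i hi)
    · rw [h1 j hj, h2] at hij; exact absurd hij.symm (hne j hj)
    · rfl
  · rw [h1 i (by omega)]
    rcases Nat.lt_succ_iff_lt_or_eq.mp hi with h' | h'
    · rw [h1 _ h']; exact h.step i h'
    · rw [h', h2]; exact hR i h'

/-- Depth-first search: a relation without long paths has a large pair of sets with no related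
pair from the first to the second. -/
theorem exists_path_or_unrelated_pair {V : Type*} [DecidableEq V] (R : V → V → Prop)
    (W : Finset V) (n s : ℕ) (hs : s ≤ #W) :
    (∃ p, IsPathIn R W p n) ∨ ∃ S U, S ⊆ W ∧ U ⊆ W ∧ Disjoint S U ∧ #S = s ∧
      #W ≤ s + #U + n ∧ ∀ x ∈ S, ∀ y ∈ U, ¬ R x y := by
  classical
  refine or_iff_not_imp_left.mpr fun hno => ?_
  cases isEmpty_or_nonempty V
  · have : W = ∅ := Finset.eq_empty_of_isEmpty W
    subst this
    exact ⟨∅, ∅, by simp_all⟩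
  -- A state of the search: `S` is the set of finished vertices, `p` the current stack of length
  -- `L`, and no finished vertex is related to an unvisited one.
  let Q : ℕ → ℕ → Prop := fun s L => ∃ S ⊆ W, #S = s ∧ ∃ p, IsPathIn R (W \ S) p L ∧
    ∀ x ∈ S, ∀ y ∈ W \ S, (∀ i < L, p i ≠ y) → ¬ R x y
  have hQn : ∀ s L, Q s L → L < n := by
    rintro s L ⟨S, -, -, p, hp, -⟩
    by_contra! hL
    exact hno ⟨p, hp.mono sdiff_subset hL⟩
  have key : ∀ s, s ≤ #W → ∃ L, Q s L := by
    intro s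
    induction s with
    | zero =>
      intro _
      exact ⟨0, ∅, by simp, by simp, fun _ => Classical.arbitrary V,
        ⟨by simp, by simp, by simp⟩, by simp⟩
    | succ s ih =>
      intro hs
      obtain ⟨L0, hL0⟩ := ih (by omega)
      -- With a stack that cannot be extended, its top is related to no unvisited vertex and can be
      -- moved into `S`. An empty stack could be extended by any vertex.
      obtain ⟨L, hL, hL'⟩ : ∃ L, Q s L ∧ ¬ Q s (L + 1) := by
        by_contra! hcon
        have : ∀ j, Q s (L0 + j) := fun j => by
          induction j with
          | zero => exact hL0
          | succ j ihj => exact hcon _ ihj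
        have := hQn _ _ (this n)
        omega
      obtain ⟨S, hSW, hSc, p, hp, hR⟩ := hL
      have hext : ∀ y ∈ W \ S, (∀ i < L, p i ≠ y) → ¬ ∀ i, i + 1 = L → R (p i) y := by
        intro y hy hne hRy
        refine hL' ⟨S, hSW, hSc, _, hp.snoc hy hne hRy, fun x hx z hz hz' => hR x hx z hz ?_⟩
        intro i hi
        have := hz' i (by omega)
        rwa [Function.update_of_ne (by omega)] at this
      cases L with
      | zero =>
        obtain ⟨v, hv⟩ : (W \ S).Nonempty := by
          rw [← card_pos, card_sdiff_of_subset hSW]; omega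
        exact absurd (by simp) (hext v hv (by simp))
      | succ L =>
        have hpL := hp.mem L (by omega)
        rw [mem_sdiff] at hpL
        refine ⟨L, insert (p L) S, insert_subset hpL.1 hSW, by
          rw [card_insert_of_notMem hpL.2, hSc], p, ⟨fun i hi => ?_, fun i hi j hj =>
            hp.inj i (by omega) j (by omega), fun i hi => hp.step i (by omega)⟩, ?_⟩
        · have h1 := hp.mem i (by omega)
          have h2 : p i ≠ p L := fun h => by
            have := hp.inj i (by omega) L (by omega) h
            omega
          simp_all
        · intro x hx y hy hne
          simp only [mem_sdiff, mem_insert, not_or] at hy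
          have hy' : y ∈ W \ S := by simp [hy]
          have hne' : ∀ i < L + 1, p i ≠ y := fun i hi => by
            rcases Nat.lt_succ_iff_lt_or_eq.mp hi with h | rfl
            · exact hne i h
            · exact fun h => hy.2.1 h.symm
          rcases mem_insert.mp hx with rfl | hx
          · intro hRx
            refine hext y hy' hne' fun i hi => ?_
            obtain rfl : i = L := by omega
            exact hRx
          · exact hR x hx y hy' hne'
  obtain ⟨L, hL⟩ := key s hs
  have hLn := hQn _ _ hL
  obtain ⟨S, hSW, hSc, p, hp, hR⟩ := hL
  refine ⟨S, (W \ S) \ (range L).image p, hSW, sdiff_subset.trans sdiff_subset, ?_, hSc, ?_, ?_⟩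
  · exact disjoint_sdiff.mono_right sdiff_subset
  · have h1 := le_card_sdiff ((range L).image p) (W \ S)
    have h2 : #((range L).image p) ≤ L := card_image_le.trans (by simp)
    have h3 := card_sdiff_of_subset hSW
    omega
  · intro x hx y hy
    simp only [mem_sdiff (s := W \ S), mem_image, mem_range, not_exists, not_and] at hy
    exact hR x hx y hy.1 hy.2

/-- A symmetric relation without long paths has many large sets that are pairwise unrelated. -/
theorem exists_path_or_unrelated_family {V : Type*} [DecidableEq V] (R : V → V → Prop)
    (hR : ∀ x y, R x y → R y x) (n M r : ℕ) (W : Finset V) (hW : r * (M + n) ≤ #W) :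
    (∃ p, IsPathIn R W p n) ∨ ∃ F : ℕ → Finset V, (∀ i < r, F i ⊆ W ∧ #(F i) = M) ∧
      ∀ i < r, ∀ j < r, i ≠ j → Disjoint (F i) (F j) ∧ ∀ x ∈ F i, ∀ y ∈ F j, ¬ R x y := by
  induction r generalizing W with
  | zero => exact Or.inr ⟨fun _ => ∅, by simp, by simp⟩
  | succ r ih =>
    have hW' : r * (M + n) + (M + n) ≤ #W := by rw [← Nat.succ_mul]; exact hW
    -- Splitting off `S` costs `M + n` points, so `U` is still large enough for the remaining `r`
    -- sets.
    rcases exists_path_or_unrelated_pair R W n M (by omega) with h | ⟨S, U, hS, hU, hd, hSc, hUc, hSU⟩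
    · exact Or.inl h
    rcases ih U (by omega) with ⟨p, hp⟩ | ⟨F, hF, hFF⟩
    · exact Or.inl ⟨p, hp.mono hU le_rfl⟩
    refine Or.inr ⟨fun i => if i < r then F i else S, fun i hi => ?_, fun i hi j hj hij => ?_⟩
    · by_cases h : i < r
      · simpa [h] using ⟨(hF i h).1.trans hU, (hF i h).2⟩
      · simpa [h] using ⟨hS, hSc⟩
    · by_cases h1 : i < r <;> by_cases h2 : j < r
      · simpa [h1, h2] using hFF i h1 j h2 hij
      · simp only [h1, h2, if_true, if_false]
        exact ⟨(hd.mono_right (hF i h1).1).symm, fun x hx y hy h =>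
          hSU y hy x ((hF i h1).1 hx) (hR _ _ h)⟩
      · simp only [h1, h2, if_true, if_false]
        exact ⟨hd.mono_right (hF j h2).1, fun x hx y hy => hSU x hx y ((hF j h2).1 hy)⟩
      · omega

/-- In a pseudo-random graph there is a long path winding around any large disjoint sets. -/
theorem exists_cyclic_path {V : Type*} [DecidableEq V] (G : SimpleGraph V) (r m n M : ℕ)
    (hr : 2 ≤ r) (hM : (r + 1) * m + n ≤ M)
    (hG : ∀ S T : Finset V, Disjoint S T → m ≤ #S → m ≤ #T → ∃ u ∈ S, ∃ v ∈ T, G.Adj u v)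
    (F : ℕ → Finset V) (hF : ∀ i < r, #(F i) = M)
    (hd : ∀ i < r, ∀ j < r, i ≠ j → Disjoint (F i) (F j)) :
    ∃ (p : ℕ → V) (s : ℕ), (∀ i < n, p i ∈ F ((s + i) % r)) ∧
      (∀ i < n, ∀ j < n, p i = p j → i = j) ∧ ∀ i, i + 1 < n → G.Adj (p i) (p (i + 1)) := by
  classical
  -- Only edges from one set to its cyclic successor count, so every directed path winds around the
  -- sets.
  let R : V → V → Prop := fun u v => ∃ i < r, u ∈ F i ∧ v ∈ F ((i + 1) % r) ∧ G.Adj u v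
  have hMr : r * m + m + n ≤ M := by linarith
  have hcard : #((range r).biUnion F) = r * M := by
    rw [card_biUnion, sum_congr rfl fun i hi => hF i (mem_range.mp hi)]
    · simp
    · intro i hi j hj hij
      exact hd i (by simpa using hi) j (by simpa using hj) hij
  have huniq : ∀ i < r, ∀ j < r, ∀ x, x ∈ F i → x ∈ F j → i = j := by
    intro i hi j hj x hx hx'
    by_contra hij
    exact disjoint_left.mp (hd i hi j hj hij) hx hx'
  -- Size `r * m` forces `m` points of `S` into some `F i`. As `U` misses at most `r * m + n` points
  -- of the union, it keeps `m` points of the next set, and pseudo-randomness gives a forbidden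
  -- edge.
  rcases exists_path_or_unrelated_pair R ((range r).biUnion F) n (r * m)
    (by rw [hcard]; exact Nat.mul_le_mul_left _ (by omega)) with
    ⟨p, hp⟩ | ⟨S, U, hS, hU, hSU, hSc, hUc, hRSU⟩
  · have hmem : ∀ i < n, ∃ j < r, p i ∈ F j := fun i hi => by simpa using hp.mem i hi
    rcases Nat.eq_zero_or_pos n with rfl | hn
    · exact ⟨p, 0, by simp, by simp, by simp⟩
    obtain ⟨s, hs, h0⟩ := hmem 0 hn
    refine ⟨p, s, fun i => ?_, hp.inj, fun i hi => ?_⟩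
    · induction i with
      | zero => intro _; simpa [Nat.mod_eq_of_lt hs] using h0
      | succ i ih =>
        intro hi
        obtain ⟨j, hj, h1, h2, -⟩ := hp.step i hi
        have := huniq j hj _ (Nat.mod_lt _ (by omega)) _ h1 (ih (by omega))
        rw [this, Nat.mod_add_mod] at h2
        exact h2
    · obtain ⟨j, hj, h1, h2, h3⟩ := hp.step i hi
      exact h3
  · exfalso
    obtain ⟨i, hi, hSi⟩ : ∃ i < r, m ≤ #(S ∩ F i) := by
      by_contra! hcon
      have h1 : S = (range r).biUnion fun i => S ∩ F i := by
        rw [← inter_biUnion, inter_eq_left.mpr hS]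
      have h2 : #S ≤ ∑ i ∈ range r, #(S ∩ F i) := by
        conv_lhs => rw [h1]
        exact card_biUnion_le
      have h3 : ∑ i ∈ range r, #(S ∩ F i) < ∑ i ∈ range r, m :=
        sum_lt_sum_of_nonempty (by simp; omega) fun i hi => hcon i (mem_range.mp hi)
      simp only [sum_const, card_range, smul_eq_mul] at h3
      omega
    have hi' : (i + 1) % r < r := Nat.mod_lt _ (by omega)
    have hne : i ≠ (i + 1) % r := by
      rcases Nat.lt_or_ge (i + 1) r with h | h
      · rw [Nat.mod_eq_of_lt h]; omega
      · have : i + 1 = r := by omega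
        rw [this, Nat.mod_self]; omega
    have hUi : m ≤ #(U ∩ F ((i + 1) % r)) := by
      set A := F ((i + 1) % r) with hA
      have hAc : #A = M := hF _ hi'
      have hAW : A ⊆ (range r).biUnion F := subset_biUnion_of_mem F (mem_range.mpr hi')
      have h1 : #(U ∪ A) + #(U ∩ A) = #U + #A := card_union_add_card_inter _ _
      have h2 : #(U ∪ A) ≤ #((range r).biUnion F) := card_le_card (union_subset hU hAW)
      omega
    obtain ⟨u, hu, v, hv, huv⟩ := hG _ _ ((hd i hi _ hi' hne).mono inter_subset_right
      inter_subset_right) hSi hUi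
    rw [mem_inter] at hu hv
    exact hRSU u hu.1 v hv.1 ⟨i, hi, hu.2, hv.2, huv⟩

/-! ### Bicliques and greedy embedding -/

/-- `G` contains a complete bipartite graph between `q`-subsets of `A` and `B`. -/
def HasBiclique {X : Type*} (G : SimpleGraph X) (q : ℕ) (A B : Finset X) : Prop :=
  ∃ A' ⊆ A, ∃ B' ⊆ B, #A' = q ∧ #B' = q ∧ ∀ x ∈ A', ∀ y ∈ B', G.Adj x y

theorem HasBiclique.symm {X : Type*} {G : SimpleGraph X} {q : ℕ} {A B : Finset X}
    (h : HasBiclique G q A B) : HasBiclique G q B A := by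
  obtain ⟨A', hA, B', hB, h1, h2, h3⟩ := h
  exact ⟨B', hB, A', hA, h2, h1, fun x hx y hy => (h3 y hy x hx).symm⟩

open Classical in
/-- If the complement of `G'` has no large biclique, then few vertices have small degree in `G'`. -/
theorem card_low_degree_lt {X : Type*} (G G' : SimpleGraph X) (q : ℕ)
    (A B : Finset X) (hAB : ∀ x ∈ A, ∀ y ∈ B, G.Adj x y ∨ G'.Adj x y)
    (hno : ¬ HasBiclique G q A B) (C D : Finset X) (hC : C ⊆ A) (hD : D ⊆ B) (s : ℕ) (hs : 0 < s)
    (hDs : 2 * q * s ≤ #D) : #{x ∈ C | #{y ∈ D | G'.Adj x y} < s} < q := by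
  by_contra! hcon
  obtain ⟨Q, hQ, hQc⟩ := exists_subset_card_eq hcon
  -- Together `q` vertices of low degree reach at most `q * s` points of `D`; the other points, at
  -- least `q` of them, would complete a biclique in `G`.
  have h1 : #(Q.biUnion fun x => {y ∈ D | G'.Adj x y}) ≤ q * s := by
    refine card_biUnion_le.trans ?_
    rw [← hQc, ← smul_eq_mul]
    exact sum_le_card_nsmul _ _ _ fun x hx => (mem_filter.mp (hQ hx)).2.le
  have h2 : q ≤ #(D \ Q.biUnion fun x => {y ∈ D | G'.Adj x y}) := by
    have := le_card_sdiff (Q.biUnion fun x => {y ∈ D | G'.Adj x y}) D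
    have h3 : q ≤ q * s := Nat.le_mul_of_pos_right _ hs
    have h4 : 2 * q * s = q * s + q * s := by ring
    omega
  obtain ⟨Q', hQ', hQc'⟩ := exists_subset_card_eq h2
  refine hno ⟨Q, fun x hx => hC (mem_filter.mp (hQ hx)).1, Q',
    fun y hy => hD (mem_sdiff.mp (hQ' hy)).1, hQc, hQc', fun x hx y hy => ?_⟩
  have hy' := mem_sdiff.mp (hQ' hy)
  refine (hAB x (hC (mem_filter.mp (hQ hx)).1) y (hD hy'.1)).resolve_right fun h => hy'.2 ?_
  exact mem_biUnion.mpr ⟨x, hx, mem_filter.mpr ⟨hy'.1, h⟩⟩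

/-- Greedy embedding of the power of a path along a sequence of sets without large bicliques in
the other colour. -/
theorem exists_transversal {X : Type*} [Nonempty X] (G G' : SimpleGraph X) (k q n : ℕ) (hq : 0 < q)
    (B : ℕ → Finset X) (hB : ∀ i < n, (k * q + 1) * (2 * q) ^ k ≤ #(B i))
    (hadj : ∀ i j, i < j → j < n → j ≤ i + k → ∀ x ∈ B i, ∀ y ∈ B j, G.Adj x y ∨ G'.Adj x y)
    (hno : ∀ i j, i < j → j < n → j ≤ i + k → ¬ HasBiclique G q (B i) (B j)) :
    ∃ x : ℕ → X, (∀ i < n, x i ∈ B i) ∧ ∀ i j, i < j → j < n → j ≤ i + k → G'.Adj (x i) (x j) := by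
  classical
  set L := k * q + 1 with hL
  -- The exponent `min k (j - m)` counts the choices still to come that constrain `x j`; each costs
  -- a factor `2 * q`. At `j = m` there remain `L = k * q + 1` candidates, more than the at most `k
  -- * q` that are bad for some later set.
  have key : ∀ m ≤ n, ∃ x : ℕ → X, (∀ i < m, x i ∈ B i) ∧
      (∀ i j, i < j → j < m → j ≤ i + k → G'.Adj (x i) (x j)) ∧
      ∀ j, m ≤ j → j < n → L * (2 * q) ^ min k (j - m) ≤
        #{y ∈ B j | ∀ i < m, j ≤ i + k → G'.Adj (x i) y} := by
    intro m
    induction m with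
    | zero =>
      intro _
      refine ⟨fun _ => Classical.arbitrary X, by simp, by simp, fun j _ hj => ?_⟩
      refine le_trans ?_ ((hB j hj).trans_eq (by simp))
      exact Nat.mul_le_mul_left _ (Nat.pow_le_pow_right (by omega) (min_le_left _ _))
    | succ m ih =>
      intro hmn
      obtain ⟨x, hxB, hxx, hxC⟩ := ih (by omega)
      set C : ℕ → Finset X := fun j => {y ∈ B j | ∀ i < m, j ≤ i + k → G'.Adj (x i) y} with hC
      have hCB : ∀ j, C j ⊆ B j := fun j => filter_subset _ _
      let s : ℕ → ℕ := fun j => L * (2 * q) ^ (j - (m + 1))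
      let bad : ℕ → Finset X := fun j => {v ∈ C m | #{y ∈ C j | G'.Adj v y} < s j}
      let J := (Ioc m (m + k)).filter (· < n)
      have hbad : ∀ j ∈ J, #(bad j) ≤ q := by
        intro j hj
        simp only [J, mem_filter, mem_Ioc] at hj
        refine (card_low_degree_lt G G' q (B m) (B j)
          (hadj m j (by omega) (by omega) (by omega)) (hno m j (by omega) (by omega) (by omega))
          (C m) (C j) (hCB _) (hCB _) (s j) (by positivity) ?_).le
        refine le_trans (le_of_eq ?_) (hxC j (by omega) (by omega))
        rw [min_eq_right (by omega), show j - m = j - (m + 1) + 1 by omega, pow_succ]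
        ring
      have hCm : L ≤ #(C m) := by simpa using hxC m le_rfl (by omega)
      have hlt : #(J.biUnion bad) < #(C m) := by
        have h1 : #(J.biUnion bad) ≤ #J * q := by
          refine card_biUnion_le.trans ?_
          rw [← smul_eq_mul]
          exact sum_le_card_nsmul _ _ _ hbad
        have h2 : #J ≤ k := (card_filter_le _ _).trans (by simp)
        have h3 : #J * q ≤ k * q := Nat.mul_le_mul_right _ h2
        omega
      obtain ⟨v, hv, hvb⟩ := exists_mem_notMem_of_card_lt_card hlt
      have h1 : ∀ i < m, Function.update x m v i = x i := fun i hi =>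
        Function.update_of_ne (by omega) _ _
      have h2 : Function.update x m v m = v := Function.update_self _ _ _
      have hv' := (mem_filter.mp hv).2
      refine ⟨Function.update x m v, fun i hi => ?_, fun i j hij hj hjk => ?_, fun j hj hjn => ?_⟩
      · rcases Nat.lt_succ_iff_lt_or_eq.mp hi with h | rfl
        · rw [h1 i h]; exact hxB i h
        · rw [h2]; exact hCB _ hv
      · rcases Nat.lt_succ_iff_lt_or_eq.mp hj with h | rfl
        · rw [h1 i (by omega), h1 j h]; exact hxx i j hij h hjk
        · rw [h1 i hij, h2]; exact hv' i hij hjk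
      · by_cases hjk : j ≤ m + k
        · have hjJ : j ∈ J := by simp only [J, mem_filter, mem_Ioc]; omega
          have hvj : ¬ #{y ∈ C j | G'.Adj v y} < s j := fun h =>
            hvb (mem_biUnion.mpr ⟨j, hjJ, mem_filter.mpr ⟨hv, h⟩⟩)
          rw [min_eq_right (by omega)]
          refine (not_lt.mp hvj).trans (card_le_card fun y hy => ?_)
          simp only [hC, mem_filter] at hy ⊢
          refine ⟨hy.1.1, fun i hi hik => ?_⟩
          rcases Nat.lt_succ_iff_lt_or_eq.mp hi with h | rfl
          · rw [h1 i h]; exact hy.1.2 i h hik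
          · rw [h2]; exact hy.2
        · have := hxC j (by omega) hjn
          rw [min_eq_left (by omega)] at this ⊢
          refine this.trans (card_le_card fun y hy => ?_)
          simp only [mem_filter] at hy ⊢
          exact ⟨hy.1, fun i hi hik => by omega⟩
  obtain ⟨x, h1, h2, -⟩ := key n le_rfl
  exact ⟨x, h1, h2⟩

/-! ### Recognising powers of paths -/

theorem natDist_le_of_walk {n : ℕ} {u v : Fin n} (w : (SimpleGraph.pathGraph n).Walk u v) :
    v.val ≤ u.val + w.length ∧ u.val ≤ v.val + w.length := by
  induction w with
  | nil => simp
  | cons h w ih =>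
    rw [SimpleGraph.pathGraph_adj] at h
    simp only [SimpleGraph.Walk.length_cons]
    omega

theorem pathPower_adj_le {n k : ℕ} {u v : Fin n} (h : (pathPower n k).Adj u v) :
    v.val ≤ u.val + k ∧ u.val ≤ v.val + k := by
  have hd : (SimpleGraph.pathGraph n).edist u v ≤ k := h.2
  have htop : (SimpleGraph.pathGraph n).edist u v ≠ ⊤ := fun h' => by
    rw [h', top_le_iff] at hd
    exact ENat.natCast_ne_top k hd
  obtain ⟨w, hw⟩ := SimpleGraph.exists_walk_of_edist_ne_top htop
  rw [← hw, Nat.cast_le] at hd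
  have := natDist_le_of_walk w
  omega

/-- A sequence of distinct vertices in which any two at distance at most `k` are adjacent is a
copy of `P_n^k`. -/
theorem pathPower_isContained {X : Type*} {G : SimpleGraph X} {n k : ℕ} (x : ℕ → X)
    (hinj : ∀ i < n, ∀ j < n, x i = x j → i = j)
    (hadj : ∀ i j, i < j → j < n → j ≤ i + k → G.Adj (x i) (x j)) :
    (pathPower n k).IsContained G := by
  refine ⟨⟨⟨fun i => x i, fun {u v} h => ?_⟩, fun u v h =>
    Fin.ext (hinj u u.2 v v.2 h)⟩⟩
  have := pathPower_adj_le h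
  rcases lt_trichotomy u.val v.val with h' | h' | h'
  · exact hadj _ _ h' v.2 this.1
  · exact absurd (Fin.ext h') h.ne
  · exact (hadj _ _ h' u.2 this.2).symm

/-- A sequence of disjoint `k`-sets, any two consecutive ones of which span a clique, contains
`P_n^k`. -/
theorem pathPower_isContained_of_blocks {X : Type*} {G : SimpleGraph X} {n k : ℕ} (hk : 0 < k)
    (Z : ℕ → Finset X) (hZ : ∀ i < n, #(Z i) = k)
    (hd : ∀ i j, i < j → j < n → Disjoint (Z i) (Z j))
    (hclique : ∀ i < n, ∀ x ∈ Z i, ∀ y ∈ Z i, x ≠ y → G.Adj x y)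
    (hcons : ∀ i, i + 1 < n → ∀ x ∈ Z i, ∀ y ∈ Z (i + 1), G.Adj x y) :
    (pathPower n k).IsContained G := by
  rcases Nat.eq_zero_or_pos n with rfl | hn
  · exact SimpleGraph.IsContained.of_isEmpty
  have hdiv : ∀ m < n, m / k < n := fun m hm => (Nat.div_le_self _ _).trans_lt hm
  have hf : ∀ i, ∃ f : ℕ → X, i < n → (∀ j < k, f j ∈ Z i) ∧
      ∀ j < k, ∀ l < k, f j = f l → j = l := by
    intro i
    by_cases hi : i < n
    · have e := (Z i).equivFinOfCardEq (hZ i hi)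
      refine ⟨fun j => e.symm (⟨j % k, Nat.mod_lt _ hk⟩), fun _ => ⟨fun j _ => Subtype.prop _,
        fun j hj l hl h => ?_⟩⟩
      have := congrArg Fin.val (e.symm.injective (Subtype.ext h))
      simpa [Nat.mod_eq_of_lt hj, Nat.mod_eq_of_lt hl] using this
    · have : Nonempty X := by
        by_contra hX
        rw [not_nonempty_iff] at hX
        have := hZ 0 hn
        rw [Finset.eq_empty_of_isEmpty (Z 0), card_empty] at this
        omega
      exact ⟨fun _ => Classical.arbitrary X, fun h => absurd h hi⟩
  choose f hf using hf
  have hmem : ∀ m < n, f (m / k) (m % k) ∈ Z (m / k) := fun m hm =>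
    (hf _ (hdiv m hm)).1 _ (Nat.mod_lt _ hk)
  have hinj : ∀ i < n, ∀ j < n, f (i / k) (i % k) = f (j / k) (j % k) → i = j := by
    intro i hi j hj hij
    have h1 : i / k = j / k := by
      have hi' := hmem i hi
      have hj' := hmem j hj
      rw [hij] at hi'
      rcases lt_trichotomy (i / k) (j / k) with h | h | h
      · exact absurd hj' (disjoint_left.mp (hd _ _ h (hdiv j hj)) hi')
      · exact h
      · exact absurd hi' (disjoint_left.mp (hd _ _ h (hdiv i hi)) hj')
    rw [h1] at hij
    have h2 := (hf _ (hdiv j hj)).2 _ (Nat.mod_lt _ hk) _ (Nat.mod_lt _ hk) hij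
    rw [← Nat.div_add_mod i k, ← Nat.div_add_mod j k, h1, h2]
  -- Indices differing by at most `k` fall in the same block or in consecutive ones.
  refine pathPower_isContained (fun m => f (m / k) (m % k)) hinj fun i j hij hj hjk => ?_
  have hne : f (i / k) (i % k) ≠ f (j / k) (j % k) := fun h =>
    hij.ne (hinj i (by omega) j hj h)
  have h1 : i / k ≤ j / k := Nat.div_le_div_right hij.le
  have h2 : j / k ≤ i / k + 1 := by
    rw [← Nat.add_div_right _ hk]; exact Nat.div_le_div_right hjk
  have hi' := hmem i (by omega)
  have hj' := hmem j hj
  rcases Nat.lt_or_ge (i / k) (j / k) with h | h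
  · have h3 : j / k = i / k + 1 := by omega
    rw [h3] at hj' ⊢
    exact hcons _ (h3 ▸ hdiv j hj) _ hi' _ hj'
  · have h3 : j / k = i / k := by omega
    rw [h3] at hj' hne ⊢
    exact hclique _ (hdiv i (by omega)) _ hi' _ hj' hne

/-- A sequence of disjoint cliques with bicliques between consecutive ones contains `P_n^k`. -/
theorem pathPower_isContained_of_bicliques {X : Type*} {G : SimpleGraph X} {n k : ℕ} (hk : 0 < k)
    (B : ℕ → Finset X) (hd : ∀ i j, i < j → j < n + 2 → Disjoint (B i) (B j))
    (hclique : ∀ i < n + 2, ∀ x ∈ B i, ∀ y ∈ B i, x ≠ y → G.Adj x y)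
    (hB : ∀ i, i + 1 < n + 2 → HasBiclique G (2 * k) (B i) (B (i + 1))) :
    (pathPower n k).IsContained G := by
  classical
  have hA : ∀ i, ∃ A A' : Finset X, i ≤ n → A ⊆ B i ∧ A' ⊆ B (i + 1) ∧ #A = 2 * k ∧ #A' = 2 * k ∧
      ∀ x ∈ A, ∀ y ∈ A', G.Adj x y := by
    intro i
    by_cases hi : i ≤ n
    · obtain ⟨A, h1, A', h2, h⟩ := hB i (by omega)
      exact ⟨A, A', fun _ => ⟨h1, h2, h⟩⟩
    · exact ⟨∅, ∅, fun h => absurd h hi⟩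
  choose A A' hA using hA
  have hY : ∀ i, ∃ Y : Finset X, i ≤ n → Y ⊆ A i ∧ #Y = k := by
    intro i
    by_cases hi : i ≤ n
    · obtain ⟨Y, h1, h2⟩ := exists_subset_card_eq (s := A i) (n := k) (by
        rw [(hA i hi).2.2.1]; omega)
      exact ⟨Y, fun _ => ⟨h1, h2⟩⟩
    · exact ⟨∅, fun h => absurd h hi⟩
  choose Y hY using hY
  have hX : ∀ i, ∃ Z : Finset X, i < n → Z ⊆ A' i \ Y (i + 1) ∧ #Z = k := by
    intro i
    by_cases hi : i < n
    · obtain ⟨Z, h1, h2⟩ := exists_subset_card_eq (s := A' i \ Y (i + 1)) (n := k) (by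
        have h1 := le_card_sdiff (Y (i + 1)) (A' i)
        have h2 := (hA i hi.le).2.2.2.1
        have h3 := (hY (i + 1) hi).2
        omega)
      exact ⟨Z, fun _ => ⟨h1, h2⟩⟩
    · exact ⟨∅, fun h => absurd h hi⟩
  choose Z hZ using hX
  -- The order is `Z 0, Y 1, Z 1, Y 2, …`. Both `Z i` and `Y (i + 1)` lie in the clique `B (i + 1)`,
  -- while `Y (i + 1)` and `Z (i + 1)` are on the two sides of a biclique. Sides of size `2 * k`
  -- leave room to keep `Z i` and `Y (i + 1)` disjoint.
  let T : ℕ → Finset X := fun m => if m % 2 = 0 then Z (m / 2) else Y (m / 2 + 1)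
  have hdiv : ∀ m < n, m / 2 < n := fun m hm => (Nat.div_le_self _ _).trans_lt hm
  have hZB : ∀ i < n, Z i ⊆ B (i + 1) := fun i hi =>
    ((hZ i hi).1.trans sdiff_subset).trans (hA i hi.le).2.1
  have hYB : ∀ i < n, Y (i + 1) ⊆ B (i + 1) := fun i hi =>
    (hY (i + 1) hi).1.trans (hA (i + 1) hi).1
  have hTB : ∀ m < n, T m ⊆ B (m / 2 + 1) := by
    intro m hm
    by_cases h : m % 2 = 0
    · simpa [T, h] using hZB _ (hdiv m hm)
    · simpa [T, h] using hYB _ (hdiv m hm)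
  have hZY : ∀ i < n, Disjoint (Z i) (Y (i + 1)) := fun i hi =>
    disjoint_sdiff_self_left.mono_left (hZ i hi).1
  refine pathPower_isContained_of_blocks hk T (fun m hm => ?_) (fun i j hij hj => ?_)
    (fun m hm x hx y hy => ?_) (fun m hm x hx y hy => ?_)
  · by_cases h : m % 2 = 0
    · simpa [T, h] using (hZ _ (hdiv m hm)).2
    · simpa [T, h] using (hY (m / 2 + 1) (hdiv m hm)).2
  · rcases Nat.lt_or_ge (i / 2) (j / 2) with h | h
    · have := hdiv j hj
      exact (hd (i / 2 + 1) (j / 2 + 1) (by omega) (by omega)).mono (hTB i (by omega)) (hTB j hj)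
    · have h1 : i % 2 = 0 := by omega
      have h2 : j % 2 ≠ 0 := by omega
      have h3 : j / 2 = i / 2 := by omega
      simp only [T, h1, h2, h3, if_true, if_false]
      exact hZY _ (hdiv i (by omega))
  · have := hdiv m hm
    exact hclique _ (by omega) x (hTB m hm hx) y (hTB m hm hy)
  · by_cases h : m % 2 = 0
    · have h2 : (m + 1) / 2 = m / 2 := by omega
      have hx' := hTB m (by omega) hx
      have hy' := hTB (m + 1) hm hy
      rw [h2] at hy'
      have := hdiv m (by omega)
      refine hclique (m / 2 + 1) (by omega) x hx' y hy' ?_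
      rintro rfl
      have h3 : (m + 1) % 2 ≠ 0 := by omega
      simp only [T, h, if_true] at hx
      simp only [T, h3, if_false, h2] at hy
      exact disjoint_left.mp (hZY _ this) hx hy
    · have h2 : (m + 1) / 2 = m / 2 + 1 := by omega
      have h3 : (m + 1) % 2 = 0 := by omega
      have h4 := hdiv (m + 1) hm
      simp only [T, h, if_false] at hx
      simp only [T, h3, if_true, h2] at hy
      rw [h2] at h4
      exact (hA (m / 2 + 1) h4.le).2.2.2.2 x ((hY _ h4.le).1 hx) y
        (mem_sdiff.mp ((hZ _ h4).1 hy)).1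

/-! ### Ramsey's theorem for cliques -/

/-- Ramsey's theorem for two colours, in terms of a pair of graphs covering all edges. -/
theorem exists_ramsey_bound (p q : ℕ) : ∃ N : ℕ, ∀ {X : Type} [DecidableEq X] (G G' : SimpleGraph X)
    (S : Finset X), (∀ x ∈ S, ∀ y ∈ S, x ≠ y → G.Adj x y ∨ G'.Adj x y) → N ≤ #S →
    (∃ T ⊆ S, #T = p ∧ ∀ x ∈ T, ∀ y ∈ T, x ≠ y → G.Adj x y) ∨
    (∃ T ⊆ S, #T = q ∧ ∀ x ∈ T, ∀ y ∈ T, x ≠ y → G'.Adj x y) := by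
  classical
  have grow : ∀ {X : Type} [DecidableEq X] (G : SimpleGraph X) (S T : Finset X) (v : X) (p : ℕ),
      v ∈ S → (T ⊆ {x ∈ S.erase v | G.Adj v x}) → #T = p →
      (∀ x ∈ T, ∀ y ∈ T, x ≠ y → G.Adj x y) →
      ∃ T ⊆ S, #T = p + 1 ∧ ∀ x ∈ T, ∀ y ∈ T, x ≠ y → G.Adj x y := by
    intro X _ G S T v p hv hT hTc hTG
    have hvT : v ∉ T := fun h => by simpa using hT h
    refine ⟨insert v T, insert_subset hv fun x hx => mem_of_mem_erase (mem_filter.mp (hT hx)).1,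
      by rw [card_insert_of_notMem hvT, hTc], fun x hx y hy hxy => ?_⟩
    rcases mem_insert.mp hx with hxv | hxT <;> rcases mem_insert.mp hy with hyv | hyT
    · exact absurd (hxv.trans hyv.symm) hxy
    · exact hxv ▸ (mem_filter.mp (hT hyT)).2
    · exact hyv ▸ (mem_filter.mp (hT hxT)).2.symm
    · exact hTG x hxT y hyT hxy
  induction p generalizing q with
  | zero => exact ⟨0, fun G G' S _ _ => Or.inl ⟨∅, by simp⟩⟩
  | succ p ihp =>
    induction q with
    | zero => exact ⟨0, fun G G' S _ _ => Or.inr ⟨∅, by simp⟩⟩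
    | succ q ihq =>
      obtain ⟨N₁, h₁⟩ := ihp (q + 1)
      obtain ⟨N₂, h₂⟩ := ihq
      refine ⟨N₁ + N₂ + 1, fun {X} _ G G' S hS hc => ?_⟩
      obtain ⟨v, hv⟩ : S.Nonempty := card_pos.mp (by omega)
      set A := {x ∈ S.erase v | G.Adj v x} with hA
      set A' := {x ∈ S.erase v | G'.Adj v x} with hA'
      have hAS : A ⊆ S := (filter_subset _ _).trans (erase_subset _ _)
      have hAS' : A' ⊆ S := (filter_subset _ _).trans (erase_subset _ _)
      have hcard : #(S.erase v) ≤ #A + #A' := by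
        refine (card_le_card fun x hx => ?_).trans (card_union_le A A')
        have hx' := mem_erase.mp hx
        rcases hS v hv x hx'.2 hx'.1.symm with h | h
        · exact mem_union_left _ (mem_filter.mpr ⟨hx, h⟩)
        · exact mem_union_right _ (mem_filter.mpr ⟨hx, h⟩)
      rw [card_erase_of_mem hv] at hcard
      rcases Nat.lt_or_ge (#A) N₁ with hlt | hge
      · rcases h₂ G G' A' (fun x hx y hy => hS x (hAS' hx) y (hAS' hy)) (by omega) with
          ⟨T, h1, h2⟩ | ⟨T, h1, h2, h3⟩
        · exact Or.inl ⟨T, h1.trans hAS', h2⟩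
        · exact Or.inr (grow G' S T v q hv h1 h2 h3)
      · rcases h₁ G G' A (fun x hx y hy => hS x (hAS hx) y (hAS hy)) hge with
          ⟨T, h1, h2, h3⟩ | ⟨T, h1, h2⟩
        · exact Or.inl (grow G S T v p hv h1 h2 h3)
        · exact Or.inr ⟨T, h1.trans hAS, h2⟩

theorem labelGraph_adj_or {V : Type*} {G : SimpleGraph V} (c : G.EdgeLabeling (Fin 2)) {x y : V}
    (h : G.Adj x y) : (c.labelGraph 0).Adj x y ∨ (c.labelGraph 1).Adj x y := by
  simp only [SimpleGraph.EdgeLabeling.labelGraph_adj]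
  have : c ⟨s(x, y), h⟩ = 0 ∨ c ⟨s(x, y), h⟩ = 1 := by omega
  exact this.imp (fun h' => ⟨h, h'⟩) (fun h' => ⟨h, h'⟩)

theorem isContained_top_of_clique {X : Type*} {G : SimpleGraph X} {t : ℕ} (T : Finset X)
    (hT : #T = t) (hG : ∀ x ∈ T, ∀ y ∈ T, x ≠ y → G.Adj x y) :
    (⊤ : SimpleGraph (Fin t)).IsContained G := by
  have e := (T.equivFinOfCardEq hT).symm
  refine ⟨⟨⟨fun i => e i, fun {u v} h => hG _ (e u).2 _ (e v).2 fun h' => h.ne ?_⟩,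
    fun u v h => e.injective (Subtype.ext h)⟩⟩
  exact e.injective (Subtype.ext h')

/-- Ramsey's theorem makes the set in the definition nonempty, so its infimum is attained rather
than being the default value `0`. -/
theorem isRamseyFor_ramseyNumber (t : ℕ) :
    IsRamseyFor 2 (⊤ : SimpleGraph (Fin (ramseyNumber (⊤ : SimpleGraph (Fin t)))))
      (⊤ : SimpleGraph (Fin t)) := by
  refine Nat.sInf_mem (s := {N : ℕ | IsRamseyFor 2 (⊤ : SimpleGraph (Fin N))
    (⊤ : SimpleGraph (Fin t))}) ?_
  obtain ⟨N, hN⟩ := exists_ramsey_bound t t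
  refine ⟨N, fun c => ?_⟩
  rcases hN (c.labelGraph 0) (c.labelGraph 1) univ
    (fun x _ y _ hxy => labelGraph_adj_or c hxy) (by simp) with ⟨T, -, h1, h2⟩ | ⟨T, -, h1, h2⟩
  · exact ⟨0, isContained_top_of_clique T h1 h2⟩
  · exact ⟨1, isContained_top_of_clique T h1 h2⟩

/-! ### Sparse pseudo-random graphs by counting -/

/-- Chooses the out-degree `d` from the density `1 / D` alone, so that avoiding a set of that
density `d` times beats the factor `4 ^ D` of the union bound. -/
theorem exists_pow_mul_lt (D : ℕ) (hD : 0 < D) : ∃ d : ℕ, 4 ^ D * (D - 1) ^ d < D ^ d := by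
  have hD' : (0 : ℝ) < D := by exact_mod_cast hD
  have hlt : ((D - 1 : ℕ) : ℝ) / D < 1 := by
    rw [div_lt_one hD']
    exact_mod_cast Nat.sub_lt hD one_pos
  obtain ⟨d, hd⟩ := exists_pow_lt_of_lt_one (show (0 : ℝ) < 1 / 4 ^ D by positivity) hlt
  refine ⟨d, ?_⟩
  rw [div_pow, div_lt_div_iff₀ (by positivity) (by positivity), one_mul] at hd
  have : (4 ^ D * (D - 1 : ℕ) ^ d : ℝ) < D ^ d := by linarith
  exact_mod_cast this

/-- Counting: some `d` functions on `N` points map no large set off another large set. -/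
theorem exists_dispersing_functions (N s d D : ℕ) (hN : 0 < N) (hs : 0 < s) (hD : 0 < D)
    (hNs : N ≤ D * s) (hd : 4 ^ D * (D - 1) ^ d < D ^ d) :
    ∃ f : Fin N → Fin d → Fin N, ∀ S T : Finset (Fin N), #S = s → #T = s →
      ∃ u ∈ S, ∃ j, f u j ∈ T := by
  classical
  rcases Nat.lt_or_ge N s with h | hsN
  · refine ⟨fun u _ => u, fun S T hS => ?_⟩
    have := card_le_univ S
    rw [Fintype.card_fin] at this
    omega
  by_contra! hcon
  -- The choices of `f` that send no point of `P.1` into `P.2`. If every `f` failed, these sets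
  -- would cover everything, but there are at most `4 ^ N ≤ (4 ^ D) ^ s` pairs.
  let bad : Finset (Fin N) × Finset (Fin N) → Finset (Fin N → Fin d → Fin N) := fun P =>
    Fintype.piFinset fun u => if u ∈ P.1 then Fintype.piFinset fun _ => P.2ᶜ else univ
  let I : Finset (Finset (Fin N) × Finset (Fin N)) := {P | #P.1 = s ∧ #P.2 = s}
  have hbad : ∀ P ∈ I, #(bad P) = ((N - s) ^ d) ^ s * (N ^ d) ^ (N - s) := by
    intro P hP
    simp only [I, mem_filter, mem_univ, true_and] at hP
    simp only [bad, Fintype.card_piFinset]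
    rw [← prod_mul_prod_compl P.1, prod_congr rfl (g := fun _ => (N - s) ^ d),
      prod_congr (s₁ := P.1ᶜ) rfl (g := fun _ => N ^ d)]
    · simp [card_compl, hP]
    · intro u hu
      simp [mem_compl.mp hu]
    · intro u hu
      simp [hu, card_compl, hP]
  have hcover : (univ : Finset (Fin N → Fin d → Fin N)) ⊆ I.biUnion bad := by
    intro f _
    obtain ⟨S, T, hS, hT, h⟩ := hcon f
    refine mem_biUnion.mpr ⟨(S, T), by simp [I, hS, hT], Fintype.mem_piFinset.mpr fun u => ?_⟩
    by_cases hu : u ∈ S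
    · simp only [hu, if_true, Fintype.mem_piFinset, mem_compl]
      exact h u hu
    · simp [hu]
  have h1 : (N ^ d) ^ N ≤ #I * (((N - s) ^ d) ^ s * (N ^ d) ^ (N - s)) := by
    have h2 := (card_le_card hcover).trans card_biUnion_le
    rw [sum_congr rfl hbad] at h2
    simpa using h2
  have h2 : #I ≤ (4 ^ D) ^ s := by
    refine (card_le_univ I).trans ?_
    rw [Fintype.card_prod, Fintype.card_finset, Fintype.card_fin, ← mul_pow, ← pow_mul]
    exact Nat.pow_le_pow_right (by norm_num) hNs
  have h3 : 4 ^ D * (N - s) ^ d < N ^ d := by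
    have h4 : D * (N - s) ≤ (D - 1) * N := by
      zify [hsN, Nat.one_le_iff_ne_zero.mpr hD.ne']
      have : (N : ℤ) ≤ D * s := by exact_mod_cast hNs
      linarith
    have h5 : D ^ d * (N - s) ^ d ≤ (D - 1) ^ d * N ^ d := by
      rw [← mul_pow, ← mul_pow]; exact Nat.pow_le_pow_left h4 d
    have h6 : 0 < N ^ d := by positivity
    refine lt_of_mul_lt_mul_left (a := D ^ d) ?_ (by positivity)
    calc D ^ d * (4 ^ D * (N - s) ^ d) = 4 ^ D * (D ^ d * (N - s) ^ d) := by ring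
      _ ≤ 4 ^ D * ((D - 1) ^ d * N ^ d) := Nat.mul_le_mul_left _ h5
      _ = (4 ^ D * (D - 1) ^ d) * N ^ d := by ring
      _ < D ^ d * N ^ d := Nat.mul_lt_mul_of_pos_right hd h6
  have h4 : (4 ^ D) ^ s * ((N - s) ^ d) ^ s < (N ^ d) ^ s := by
    rw [← mul_pow]
    exact Nat.pow_lt_pow_left h3 hs.ne'
  have h5 : (N ^ d) ^ N = (N ^ d) ^ s * (N ^ d) ^ (N - s) := by
    rw [← pow_add, Nat.add_sub_cancel' hsN]
  have h6 : 0 < (N ^ d) ^ (N - s) := by positivity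
  have h7 := h1.trans (Nat.mul_le_mul_right _ h2)
  rw [← mul_assoc, h5] at h7
  exact absurd (lt_of_mul_lt_mul_right (h7.trans_lt (Nat.mul_lt_mul_of_pos_right h4 h6))
    (Nat.zero_le _)) (lt_irrefl _)

/-- Bounded degree graphs on `a * n` vertices with an edge between any two sets of `n / q`
vertices. -/
theorem exists_bounded_degree_pseudoRandom (a q : ℕ) (ha : 0 < a) (hq : 0 < q) :
    ∃ b : ℕ, ∀ n : ℕ, 0 < n → ∃ H : SimpleGraph (Fin (a * n)),
      (∀ S T : Finset (Fin (a * n)), Disjoint S T → n ≤ q * #S → n ≤ q * #T →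
        ∃ u ∈ S, ∃ v ∈ T, H.Adj u v) ∧
      ∀ v, (H.neighborSet v).encard ≤ (b : ℕ∞) := by
  classical
  obtain ⟨d, hd⟩ := exists_pow_mul_lt (2 * a * q) (by positivity)
  have hd0 : 0 < d := by
    rcases Nat.eq_zero_or_pos d with rfl | h
    · simp at hd
    · exact h
  refine ⟨3 * d, fun n hn => ?_⟩
  set N := 2 * (a * n) with hN
  -- Here `s` is `n / q` rounded up.
  obtain ⟨s, hs0, hs1, hs2⟩ : ∃ s, 0 < s ∧ n ≤ q * s ∧ ∀ x, n ≤ q * x → s ≤ x := by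
    have hex : ∃ s, n ≤ q * s := ⟨n, Nat.le_mul_of_pos_left _ hq⟩
    refine ⟨Nat.find hex, ?_, Nat.find_spec hex, fun x hx => Nat.find_min' hex hx⟩
    by_contra! h
    have := Nat.find_spec hex
    rw [Nat.le_zero.mp h] at this
    omega
  obtain ⟨f, hf⟩ := exists_dispersing_functions N s d (2 * a * q) (by positivity) hs0
    (by positivity) (by
      calc N = 2 * a * n := by rw [hN]; ring
        _ ≤ 2 * a * (q * s) := Nat.mul_le_mul_left _ hs1
        _ = 2 * a * q * s := by ring) hd
  let pre : Fin N → Finset (Fin N × Fin d) := fun v => {x | f x.1 x.2 = v}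
  have hsum : ∑ v, #(pre v) = N * d := by
    have := card_eq_sum_card_fiberwise (s := (univ : Finset (Fin N × Fin d))) (t := univ)
      (f := fun x => f x.1 x.2) (by simp)
    rw [← this]
    simp
  let good : Finset (Fin N) := {v | #(pre v) ≤ 2 * d}
  have hgood : a * n ≤ #good := by
    have h1 : #goodᶜ * (2 * d) ≤ N * d := by
      rw [← hsum, ← smul_eq_mul]
      refine (card_nsmul_le_sum goodᶜ (fun v => #(pre v)) _ fun v hv => ?_).trans
        (sum_le_sum_of_subset (subset_univ _))
      simp only [good, mem_compl, mem_filter, mem_univ, true_and] at hv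
      omega
    have h2 : #goodᶜ * 2 ≤ N := by
      refine Nat.le_of_mul_le_mul_right (?_ : #goodᶜ * 2 * d ≤ N * d) hd0
      rwa [mul_assoc]
    have h3 := card_add_card_compl good
    rw [Fintype.card_fin] at h3
    omega
  obtain ⟨A, hA, hAc⟩ := exists_subset_card_eq hgood
  let e : Fin (a * n) ↪ Fin N := (A.equivFinOfCardEq hAc).symm.toEmbedding.trans
    (Function.Embedding.subtype _)
  have heA : ∀ x, e x ∈ good := fun x => hA ((A.equivFinOfCardEq hAc).symm x).2
  let H : SimpleGraph (Fin (a * n)) :=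
    { Adj := fun x y => x ≠ y ∧ ((∃ j, f (e x) j = e y) ∨ ∃ j, f (e y) j = e x)
      symm := ⟨fun _ _ h => ⟨h.1.symm, h.2.symm⟩⟩
      loopless := ⟨fun _ h => h.1 rfl⟩ }
  refine ⟨H, fun S T hST hS hT => ?_, fun v => ?_⟩
  · obtain ⟨S', hS', hSc⟩ := exists_subset_card_eq (hs2 _ hS)
    obtain ⟨T', hT', hTc⟩ := exists_subset_card_eq (hs2 _ hT)
    obtain ⟨u, hu, j, hj⟩ := hf (S'.map e) (T'.map e) (by simpa) (by simpa)
    obtain ⟨x, hx, rfl⟩ := mem_map.mp hu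
    obtain ⟨y, hy, hxy⟩ := mem_map.mp hj
    refine ⟨x, hS' hx, y, hT' hy, ?_, Or.inl ⟨j, hxy.symm⟩⟩
    rintro rfl
    exact disjoint_left.mp hST (hS' hx) (hT' hy)
  · let N₁ : Finset (Fin (a * n)) := {y | ∃ j, f (e v) j = e y}
    let N₂ : Finset (Fin (a * n)) := {y | ∃ j, f (e y) j = e v}
    have hsub : H.neighborSet v ⊆ (N₁ ∪ N₂ : Finset _) := by
      intro y hy
      have hy' : H.Adj v y := hy
      simpa [N₁, N₂] using hy'.2
    have h1 : #N₁ ≤ d := by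
      rw [← card_map e]
      refine (card_le_card (t := univ.image (f (e v))) fun y hy => ?_).trans
        (card_image_le.trans (by simp))
      obtain ⟨x, hx, rfl⟩ := mem_map.mp hy
      simpa [N₁] using hx
    have h2 : #N₂ ≤ 2 * d := by
      have h3 : #(pre (e v)) ≤ 2 * d := (mem_filter.mp (heA v)).2
      refine le_trans ?_ h3
      rw [← card_map e]
      refine (card_le_card (t := (pre (e v)).image Prod.fst) fun y hy => ?_).trans card_image_le
      obtain ⟨x, hx, rfl⟩ := mem_map.mp hy
      simpa [N₂, pre] using hx
    refine (Set.encard_le_encard hsub).trans ?_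
    rw [Set.encard_coe_eq_coe_finsetCard, Nat.cast_le]
    have := card_union_le N₁ N₂
    omega

/-! ### Degrees in powers and blow-ups -/

theorem edgeSet_encard_le {V : Type*} [Fintype V] (G : SimpleGraph V) (b : ℕ)
    (hb : ∀ v, (G.neighborSet v).encard ≤ (b : ℕ∞)) :
    G.edgeSet.encard ≤ ((Fintype.card V * b : ℕ) : ℕ∞) := by
  classical
  have h1 : G.edgeSet ⊆ ⋃ v, (fun u => s(v, u)) '' G.neighborSet v := by
    intro e he
    induction e using Sym2.inductionOn with
    | hf x y => exact Set.mem_iUnion.mpr ⟨x, y, he, rfl⟩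
  refine (Set.encard_le_encard h1).trans ?_
  refine (Set.encard_iUnion_le_of_fintype _).trans ?_
  refine (sum_le_sum (g := fun _ => (b : ℕ∞)) fun v _ => (Set.encard_image_le _ _).trans (hb v)).trans ?_
  simp

theorem walkBall_encard_le {V : Type*} (G : SimpleGraph V) (b : ℕ)
    (hb : ∀ v, (G.neighborSet v).encard ≤ (b : ℕ∞)) (k : ℕ) (v : V) :
    {u | ∃ w : G.Walk v u, w.length ≤ k}.encard ≤ (((b + 1) ^ k : ℕ) : ℕ∞) := by
  classical
  induction k generalizing v with
  | zero =>
    simp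
  | succ k ih =>
    have hfin : (insert v (G.neighborSet v)).Finite :=
      ((Set.finite_of_encard_le_coe (hb v)).insert v)
    have hsub : {u | ∃ w : G.Walk v u, w.length ≤ k + 1} ⊆
        ⋃ x ∈ hfin.toFinset, {u | ∃ w : G.Walk x u, w.length ≤ k} := by
      rintro u ⟨w, hw⟩
      cases w with
      | nil => exact Set.mem_biUnion (x := v) (by simp) ⟨.nil, by simp⟩
      | @cons _ x _ h w =>
        exact Set.mem_biUnion (x := x) (by simp [h]) ⟨w, by simpa using hw⟩
    have hc : #hfin.toFinset ≤ b + 1 := by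
      have h1 := (Set.encard_insert_le (G.neighborSet v) v).trans (add_le_add_left (hb v) 1)
      rw [← hfin.coe_toFinset, Set.encard_coe_eq_coe_finsetCard] at h1
      exact_mod_cast h1
    refine (Set.encard_le_encard hsub).trans ((Finset.set_encard_biUnion_le _ _).trans ?_)
    refine (sum_le_sum fun x _ => ih x).trans ?_
    rw [sum_const, nsmul_eq_mul, pow_succ', ← Nat.cast_mul, Nat.cast_le]
    exact Nat.mul_le_mul_right _ hc

theorem power_neighborSet_encard_le {V : Type*} (G : SimpleGraph V) (b : ℕ)
    (hb : ∀ v, (G.neighborSet v).encard ≤ (b : ℕ∞)) (k : ℕ) (v : V) :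
    ((power G k).neighborSet v).encard ≤ (((b + 1) ^ k : ℕ) : ℕ∞) := by
  refine (Set.encard_le_encard fun u hu => ?_).trans (walkBall_encard_le G b hb k v)
  have hd : G.edist v u ≤ k := hu.2
  have htop : G.edist v u ≠ ⊤ := fun h' => by
    rw [h', top_le_iff] at hd
    exact ENat.natCast_ne_top k hd
  obtain ⟨w, hw⟩ := SimpleGraph.exists_walk_of_edist_ne_top htop
  rw [← hw, Nat.cast_le] at hd
  exact ⟨w, hd⟩

theorem completeBlowup_neighborSet_encard_le {V : Type*} (G : SimpleGraph V) (b t : ℕ)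
    (hb : ∀ v, (G.neighborSet v).encard ≤ (b : ℕ∞)) (x) :
    ((completeBlowup t G).neighborSet x).encard ≤
      (((b + 1) * ramseyNumber (⊤ : SimpleGraph (Fin t)) : ℕ) : ℕ∞) := by
  have hsub : (completeBlowup t G).neighborSet x ⊆
      (insert x.1 (G.neighborSet x.1)) ×ˢ Set.univ := by
    intro y hy
    have hy' : (completeBlowup t G).Adj x y := hy
    refine ⟨?_, trivial⟩
    rcases hy'.2 with h | h
    · exact Or.inl h.symm
    · exact Or.inr h
  refine (Set.encard_le_encard hsub).trans ?_
  rw [Set.encard_prod, Set.encard_univ, Nat.cast_mul]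
  refine mul_le_mul' ?_ (by simp)
  refine (Set.encard_insert_le _ _).trans ?_
  push_cast
  gcongr
  exact hb _

/-! ### The colouring argument -/

/-- If every cluster of a large set has a clique of one colour, then a power of a path in one of
the two colours exists. -/
theorem pathPower_isContained_or {V X : Type*} [DecidableEq V] (H : SimpleGraph V) (k n m M : ℕ)
    (hk : 0 < k) (hM : (k + 2) * m + n ≤ M)
    (hH : ∀ S T : Finset V, Disjoint S T → m ≤ #S → m ≤ #T → ∃ u ∈ S, ∃ v ∈ T, H.Adj u v)
    (W : Finset V) (hW : (k + 1) * (M + (n + 2)) ≤ #W) (B : V → Finset X)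
    (hd : ∀ u v, u ≠ v → Disjoint (B u) (B v))
    (hB : ∀ v ∈ W, (k * (2 * k) + 1) * (2 * (2 * k)) ^ k ≤ #(B v)) (G G' : SimpleGraph X)
    (hG : ∀ v ∈ W, ∀ x ∈ B v, ∀ y ∈ B v, x ≠ y → G.Adj x y)
    (hGG' : ∀ u ∈ W, ∀ v ∈ W, (power H k).Adj u v → ∀ x ∈ B u, ∀ y ∈ B v,
      G.Adj x y ∨ G'.Adj x y) :
    (pathPower n k).IsContained G ∨ (pathPower n k).IsContained G' := by
  rcases Nat.eq_zero_or_pos n with rfl | hn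
  · exact Or.inl SimpleGraph.IsContained.of_isEmpty
  rcases exists_path_or_unrelated_family (fun u v => HasBiclique G (2 * k) (B u) (B v))
    (fun _ _ h => h.symm) (n + 2) M (k + 1) W hW with ⟨p, hp⟩ | ⟨F, hF, hFF⟩
  · refine Or.inl (pathPower_isContained_of_bicliques hk (fun i => B (p i))
      (fun i j hij hj => hd _ _ fun h => hij.ne (hp.inj i (by omega) j hj h))
      (fun i hi => hG _ (hp.mem i hi)) hp.step)
  · right
    -- With `k + 1` sets in cyclic order, any `k + 1` consecutive vertices of the path lie in
    -- distinct sets.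
    obtain ⟨p, s, hpF, hpinj, hpadj⟩ := exists_cyclic_path H (k + 1) m n M (by omega) hM hH F
      (fun i hi => (hF i hi).2) (fun i hi j hj hij => (hFF i hi j hj hij).1)
    have hmod : ∀ i, (s + i) % (k + 1) < k + 1 := fun i => Nat.mod_lt _ (by omega)
    have hpW : ∀ i < n, p i ∈ W := fun i hi => (hF _ (hmod i)).1 (hpF i hi)
    have hwalk : ∀ j i, i + j < n → ∃ w : H.Walk (p i) (p (i + j)), w.length = j := by
      intro j
      induction j with
      | zero => exact fun i _ => ⟨.nil, rfl⟩
      | succ j ih =>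
        intro i hi
        obtain ⟨w, hw⟩ := ih i (by omega)
        exact ⟨w.concat (hpadj (i + j) (by omega)), by simp [hw]⟩
    have hpow : ∀ i j, i < j → j < n → j ≤ i + k → (power H k).Adj (p i) (p j) := by
      intro i j hij hj hjk
      refine ⟨fun h => hij.ne (hpinj i (by omega) j hj h), ?_⟩
      obtain ⟨l, rfl⟩ := Nat.exists_eq_add_of_lt hij
      obtain ⟨w, hw⟩ := hwalk (l + 1) i hj
      refine (SimpleGraph.edist_le w).trans ?_
      rw [hw, Nat.cast_le]
      omega
    have hne : ∀ i j, i < j → j ≤ i + k → (s + i) % (k + 1) ≠ (s + j) % (k + 1) := by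
      intro i j hij hjk h
      have h1 : (k + 1) ∣ (s + j) - (s + i) := (Nat.modEq_iff_dvd' (by omega)).mp h
      have := Nat.le_of_dvd (by omega) h1
      omega
    have : Nonempty X := by
      have h1 := hB _ (hpW 0 hn)
      have h2 : 0 < #(B (p 0)) := lt_of_lt_of_le (by positivity) h1
      exact ⟨(card_pos.mp h2).choose⟩
    obtain ⟨x, hx, hxx⟩ := exists_transversal G G' k (2 * k) n (by omega) (fun i => B (p i))
      (fun i hi => hB _ (hpW i hi))
      (fun i j hij hj hjk => hGG' _ (hpW i (by omega)) _ (hpW j hj) (hpow i j hij hj hjk))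
      (fun i j hij hj hjk => (hFF _ (hmod i) _ (hmod j) (hne i j hij hjk)).2 _ (hpF i (by omega)) _
        (hpF j hj))
    refine pathPower_isContained x (fun i hi j hj hij => ?_) hxx
    by_contra hne'
    have hp : p i ≠ p j := fun h => hne' (hpinj i hi j hj h)
    exact disjoint_left.mp (hd _ _ hp) (hx i hi) (hij ▸ hx j hj)

/-- The value of `t` is the clique size that the greedy embedding needs against bicliques of side `2
* k`. The factor `2` in `hV` pays for passing to the majority colour of the cliques. -/
theorem isRamseyFor_completeBlowup {V : Type*} [Fintype V] (H : SimpleGraph V) (k n m M t : ℕ)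
    (hk : 0 < k) (ht : t = (k * (2 * k) + 1) * (2 * (2 * k)) ^ k) (hM : (k + 2) * m + n ≤ M)
    (hH : ∀ S T : Finset V, Disjoint S T → m ≤ #S → m ≤ #T → ∃ u ∈ S, ∃ v ∈ T, H.Adj u v)
    (hV : 2 * ((k + 1) * (M + (n + 2))) ≤ Fintype.card V) :
    IsRamseyFor 2 (completeBlowup t (power H k)) (pathPower n k) := by
  classical
  intro c
  set R := ramseyNumber (⊤ : SimpleGraph (Fin t)) with hR
  have hmono : ∀ v : V, ∃ (i : Fin 2) (B : Finset (V × Fin R)), (∀ x ∈ B, x.1 = v) ∧ #B = t ∧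
      ∀ x ∈ B, ∀ y ∈ B, x ≠ y → (c.labelGraph i).Adj x y := by
    intro v
    let g : (⊤ : SimpleGraph (Fin R)) →g completeBlowup t (power H k) :=
      ⟨fun x => (v, x), fun {x y} h => ⟨fun h' => h (Prod.ext_iff.mp h').2, Or.inl rfl⟩⟩
    obtain ⟨i, ⟨f⟩⟩ := isRamseyFor_ramseyNumber t (c.pullback g)
    have hinj : Function.Injective fun j => (v, f j) := fun j l h =>
      f.injective (Prod.ext_iff.mp h).2
    refine ⟨i, univ.image fun j => (v, f j), by simp, by simp [card_image_of_injective _ hinj], ?_⟩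
    intro x hx y hy hxy
    obtain ⟨j, -, rfl⟩ := mem_image.mp hx
    obtain ⟨l, -, rfl⟩ := mem_image.mp hy
    have hjl : (⊤ : SimpleGraph (Fin t)).Adj j l := fun h => hxy (by rw [h])
    have := f.toHom.map_adj hjl
    rw [SimpleGraph.EdgeLabeling.labelGraph_adj] at this ⊢
    obtain ⟨h1, h2⟩ := this
    exact ⟨g.map_adj h1, h2⟩
  choose col B hB1 hB2 hB3 using hmono
  have hd : ∀ u v, u ≠ v → Disjoint (B u) (B v) := fun u v huv =>
    disjoint_left.mpr fun x hx hx' => huv ((hB1 u x hx).symm.trans (hB1 v x hx'))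
  have hadj : ∀ u v, (power H k).Adj u v → ∀ x ∈ B u, ∀ y ∈ B v,
      (c.labelGraph 0).Adj x y ∨ (c.labelGraph 1).Adj x y := by
    intro u v huv x hx y hy
    refine labelGraph_adj_or c ⟨?_, Or.inr ?_⟩
    · rintro rfl
      exact huv.ne ((hB1 u x hx).symm.trans (hB1 v x hy))
    · rw [hB1 u x hx, hB1 v y hy]; exact huv
  have hsplit : #{v | col v = 0} + #{v | col v = 1} = Fintype.card V := by
    rw [← card_univ, ← card_filter_add_card_filter_not (s := univ) (fun v => col v = 0)]
    congr 2
    ext v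
    simp only [mem_filter, mem_univ, true_and]
    omega
  rcases Nat.lt_or_ge (#{v | col v = 0}) ((k + 1) * (M + (n + 2))) with h | h
  · rcases pathPower_isContained_or H k n m M hk hM hH {v | col v = 1} (by omega) B hd
      (fun v _ => by rw [hB2, ht]) (c.labelGraph 1) (c.labelGraph 0)
      (fun v hv => (mem_filter.mp hv).2 ▸ hB3 v)
      (fun u _ v _ huv x hx y hy => (hadj u v huv x hx y hy).symm) with h' | h'
    · exact ⟨1, h'⟩
    · exact ⟨0, h'⟩
  · rcases pathPower_isContained_or H k n m M hk hM hH {v | col v = 0} h B hd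
      (fun v _ => by rw [hB2, ht]) (c.labelGraph 0) (c.labelGraph 1)
      (fun v hv => (mem_filter.mp hv).2 ▸ hB3 v)
      (fun u _ v _ huv => hadj u v huv) with h' | h'
    · exact ⟨0, h'⟩
    · exact ⟨1, h'⟩

/-! ### Choice of constants and conclusion -/

theorem IsRamseyFor.of_iso {V V' W : Type*} {q : ℕ} {G : SimpleGraph V} {G' : SimpleGraph V'}
    {H : SimpleGraph W} (h : IsRamseyFor q G H) (e : G ≃g G') : IsRamseyFor q G' H := by
  intro c
  obtain ⟨i, hi⟩ := h (c.pullback e.toHom)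
  refine ⟨i, hi.trans ⟨⟨⟨e, fun {x y} hxy => ?_⟩, e.injective⟩⟩⟩
  rw [SimpleGraph.EdgeLabeling.labelGraph_adj] at hxy ⊢
  obtain ⟨h1, h2⟩ := hxy
  exact ⟨e.toHom.map_adj h1, h2⟩

theorem sizeRamseyNumber_le_of_isRamseyFor {V W : Type*} [Fintype V] {G : SimpleGraph V}
    {H : SimpleGraph W} (h : IsRamseyFor 2 G H) : sizeRamseyNumber H ≤ G.edgeSet.encard := by
  let e := SimpleGraph.Iso.map (Fintype.equivFin V) G
  refine (iInf_le_of_le (Fintype.card V) (iInf_le_of_le _ (iInf_le_of_le (h.of_iso e) ?_)))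
  exact (Set.encard_congr e.mapEdgeSet).ge

/-- Blow-ups of powers of bounded degree pseudo-random graphs are Ramsey for powers of paths. -/
theorem exists_pseudoRandom_blowup_isRamseyFor (k : ℕ) (hk : 0 < k) :
    ∃ t : ℕ, ∀ ε : ℝ, 0 < ε → ∃ a b C : ℕ, ∀ᶠ n : ℕ in Filter.atTop,
      ∃ H : SimpleGraph (Fin (a * n)), IsPseudoRandom H (ε * (n : ℝ)) ∧
        (∀ v, (H.neighborSet v).encard ≤ (b : ℕ∞)) ∧
        (completeBlowup t (power H k)).edgeSet.encard ≤ (C : ℕ∞) * (n : ℕ∞) ∧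
        IsRamseyFor 2 (completeBlowup t (power H k)) (pathPower n k) := by
  refine ⟨(k * (2 * k) + 1) * (2 * (2 * k)) ^ k, fun ε hε => ?_⟩
  set t := (k * (2 * k) + 1) * (2 * (2 * k)) ^ k with ht
  set R := ramseyNumber (⊤ : SimpleGraph (Fin t)) with hR
  -- Then `ε * n ≤ #S` implies `n ≤ q * #S`.
  obtain ⟨q, hq⟩ := exists_nat_gt (1 / ε)
  have hq0 : 0 < q := by
    have : (0 : ℝ) < q := lt_trans (by positivity) hq
    exact_mod_cast this
  have hqε : 1 < q * ε := by rwa [div_lt_iff₀ hε] at hq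
  -- Below, `m = n` and `M = (k + 3) * n`, and `M + (n + 2) ≤ (k + 6) * n` since `n ≥ 1`. The Ramsey
  -- property only uses sets of size `n`, so `a` does not depend on `ε`.
  set a := 2 * ((k + 1) * (k + 6)) with ha
  obtain ⟨b, hb⟩ := exists_bounded_degree_pseudoRandom a q (by positivity) hq0
  refine ⟨a, b, a * R * (((b + 1) ^ k + 1) * R), ?_⟩
  filter_upwards [Filter.eventually_gt_atTop 0] with n hn
  obtain ⟨H, hH, hHb⟩ := hb n hn
  refine ⟨H, fun S T hST hS hT => hH S T hST ?_ ?_, hHb, ?_, ?_⟩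
  · have : (n : ℝ) ≤ q * #S := by nlinarith [(Nat.cast_nonneg n : (0 : ℝ) ≤ n)]
    exact_mod_cast this
  · have : (n : ℝ) ≤ q * #T := by nlinarith [(Nat.cast_nonneg n : (0 : ℝ) ≤ n)]
    exact_mod_cast this
  · refine (edgeSet_encard_le _ _ (completeBlowup_neighborSet_encard_le _ _ t
      (power_neighborSet_encard_le H b hHb k))).trans ?_
    rw [← Nat.cast_mul, Nat.cast_le, Fintype.card_prod, Fintype.card_fin, Fintype.card_fin, ← hR]
    apply le_of_eq
    ring
  · refine isRamseyFor_completeBlowup H k n n ((k + 3) * n) t hk ht (by apply le_of_eq; ring)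
      (fun S T hST hS hT => hH S T hST ?_ ?_) ?_
    · exact hS.trans (Nat.le_mul_of_pos_left _ hq0)
    · exact hT.trans (Nat.le_mul_of_pos_left _ hq0)
    · rw [Fintype.card_fin, ha, mul_assoc, mul_assoc]
      refine Nat.mul_le_mul_left _ (Nat.mul_le_mul_left _ ?_)
      have : (k + 6) * n = (k + 3) * n + (n + 2 * n) := by ring
      omega

end SizeRamsey

theorem theorem1p1 (k : ℕ) (hk : 2 ≤ k) :
    (∃ C : ℕ, ∀ᶠ n : ℕ in Filter.atTop,
      SizeRamsey.sizeRamseyNumber (SizeRamsey.pathPower n k) ≤ (C : ℕ∞) * (n : ℕ∞)) ∧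
    (∃ t : ℕ, ∀ ε : ℝ, 0 < ε → ∃ a b C : ℕ, ∀ᶠ n : ℕ in Filter.atTop,
      ∃ H : SimpleGraph (Fin (a * n)),
        SizeRamsey.IsPseudoRandom H (ε * (n : ℝ)) ∧
        (∀ v, (H.neighborSet v).encard ≤ (b : ℕ∞)) ∧
        (SizeRamsey.completeBlowup t (SizeRamsey.power H k)).edgeSet.encard
          ≤ (C : ℕ∞) * (n : ℕ∞) ∧
        SizeRamsey.IsRamseyFor 2 (SizeRamsey.completeBlowup t (SizeRamsey.power H k))
          (SizeRamsey.pathPower n k)) := by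
  have main := SizeRamsey.exists_pseudoRandom_blowup_isRamseyFor k (by omega)
  refine ⟨?_, main⟩
  obtain ⟨t, ht⟩ := main
  -- Any positive `ε` would do.
  obtain ⟨a, b, C, h⟩ := ht 1 one_pos
  refine ⟨C, h.mono fun n ⟨H, _, _, hE, hRam⟩ => ?_⟩
  exact (SizeRamsey.sizeRamseyNumber_le_of_isRamseyFor hRam).trans hE
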